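/- Let $\sigma,K,T>0$, $r\in\mathbb R$, $h(x)=(K-e^x)^+$, $\mathcal L=\tfrac12\sigma^2\partial_{xx}+(r-\tfrac12\sigma^2)\partial_x-r$, and for $\lambda>0$ let $H_\lambda(x,\pi,v)=(h(x)-v)\pi+\lambda(\pi-\pi\log\pi)$. A bounded classical solution below means a bounded continuous function on $\mathbb R\times[0,T]$ whose derivatives $\partial_t u,\partial_x u,\partial_{xx}u$ exist and are continuous on $\mathbb R\times[0,T)$ and which satisfies the equation there (the time derivative at $t=0$ is one-sided); $\|\cdot\|_\infty$ is the supremum norm on $\mathbb R\times[0,T]$. For $\lambda>0$ let $u^\lambda$ be a bounded classical solution of $$\partial_t u^\lambda+\mathcal L u^\lambda+\lambda\exp\Big(-\frac{u^\lambda-h}{\lambda}\Big)=0,\qquad u^\lambda(x,T)=h(x).$$ Fix a bounded continuous $u^0:\mathbb R\to\mathbb R$, regarded as a function of $(x,t)$ that does not depend on $t$, and let $(u^n,\pi^n)_{n\ge1}$ be generated by policy iteration: for $n\ge0$, $$\pi^{n+1}(x,t)=\operatorname*{argmax}_{\pi\in(0,\infty)}H_\lambda(x,\pi,u^n(x,t))=\exp\Big(-\frac{u^n(x,t)-h(x)}{\lambda}\Big),$$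 and $u^{n+1}$ is a bounded classical solution of $$\partial_t u^{n+1}+\mathcal L u^{n+1}+H_\lambda\big(x,\pi^{n+1}(x,t),u^{n+1}\big)=0,\qquad u^{n+1}(x,T)=h(x).$$ Put $M=\|(h-u^1)^+\|_\infty$ (which may depend on $\lambda$). Then for every $\lambda_0>0$ there is a constant $C>0$, depending only on $\sigma,r,K,T,u^0,\lambda_0$ and not on $\lambda$ or $n$, such that for all $\lambda\in(0,\lambda_0]$ and all $n\ge1$, $$\|u^{n+1}-u^\lambda\|_\infty\le C^n\,\frac{T^n}{n!}\,\exp\Big(n\Big(\frac M\lambda+rT\Big)\Big).$$ -/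

import Mathlib

/-! Randomized optimal stopping of an American put: the HJB equation and policy iteration,
in the log-price variable `x` and the time variable `t ∈ [0, T]`.
Functions of `(x, t)` are written `u : ℝ → ℝ → ℝ`; only their values for `t ∈ [0, T]` matter. -/

namespace RandomizedStopping

/-- Put payoff `g(S) = (K - S)⁺`. -/
noncomputable def g (K S : ℝ) : ℝ := max (K - S) 0

/-- Payoff in the log-price variable, `h(x) = g(eˣ)`. -/
noncomputable def h (K x : ℝ) : ℝ := g K (Real.exp x)

/-- The exploration reward `R(p) = p - p log p`. -/
noncomputable def R (p : ℝ) : ℝ := p - p * Real.log p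

/-- The Hamiltonian `H(x, p, v) = (h(x) - v) p + lam R(p)`. -/
noncomputable def H (K lam x p v : ℝ) : ℝ := (h K x - v) * p + lam * R p

/-- Time derivative; it is one-sided at `t = 0`. -/
noncomputable def dt (T : ℝ) (u : ℝ → ℝ → ℝ) (x t : ℝ) : ℝ :=
  derivWithin (fun s => u x s) (Set.Icc 0 T) t

/-- First space derivative. -/
noncomputable def dx (u : ℝ → ℝ → ℝ) (x t : ℝ) : ℝ := deriv (fun y => u y t) x

/-- Second space derivative. -/
noncomputable def dxx (u : ℝ → ℝ → ℝ) (x t : ℝ) : ℝ := deriv (fun y => dx u y t) x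

/-- The operator `½ σ² ∂ₓₓ + (r - ½ σ²) ∂ₓ - r`. -/
noncomputable def generator (σ r : ℝ) (u : ℝ → ℝ → ℝ) (x t : ℝ) : ℝ :=
  (1 / 2) * σ ^ 2 * dxx u x t + (r - (1 / 2) * σ ^ 2) * dx u x t - r * u x t

/-- `u` is bounded and continuous on `ℝ × [0, T]`, and it has derivatives `∂ₜ u`, `∂ₓ u`, `∂ₓₓ u`
on `ℝ × [0, T)` that are continuous there. -/
structure IsBoundedClassical (T : ℝ) (u : ℝ → ℝ → ℝ) : Prop where
  bounded : ∃ B : ℝ, ∀ x : ℝ, ∀ t ∈ Set.Icc 0 T, |u x t| ≤ B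
  continuousOn : ContinuousOn (fun q : ℝ × ℝ => u q.1 q.2) (Set.univ ×ˢ Set.Icc 0 T)
  differentiable_t : ∀ x : ℝ, ∀ t ∈ Set.Ico 0 T,
    DifferentiableWithinAt ℝ (fun s => u x s) (Set.Icc 0 T) t
  differentiable_x : ∀ x : ℝ, ∀ t ∈ Set.Ico 0 T, DifferentiableAt ℝ (fun y => u y t) x
  differentiable_xx : ∀ x : ℝ, ∀ t ∈ Set.Ico 0 T, DifferentiableAt ℝ (fun y => dx u y t) x
  continuousOn_dt : ContinuousOn (fun q : ℝ × ℝ => dt T u q.1 q.2) (Set.univ ×ˢ Set.Ico 0 T)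
  continuousOn_dx : ContinuousOn (fun q : ℝ × ℝ => dx u q.1 q.2) (Set.univ ×ˢ Set.Ico 0 T)
  continuousOn_dxx : ContinuousOn (fun q : ℝ × ℝ => dxx u q.1 q.2) (Set.univ ×ˢ Set.Ico 0 T)

/-- `u` is a bounded classical solution of the HJB equation
`∂ₜ u + L u + lam exp (-(u - h) / lam) = 0` on `ℝ × [0, T)`, `u(x, T) = h(x)`:
the optimal value function at temperature `lam`. -/
structure IsOptimalValue (σ r K T lam : ℝ) (u : ℝ → ℝ → ℝ) : Prop where
  classical : IsBoundedClassical T u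
  equation : ∀ x : ℝ, ∀ t ∈ Set.Ico 0 T,
    dt T u x t + generator σ r u x t + lam * Real.exp (-(u x t - h K x) / lam) = 0
  terminal : ∀ x : ℝ, u x T = h K x

/-- `u` is a bounded classical solution of
`∂ₜ u + L u + H(x, pol(x, t), u) = 0` on `ℝ × [0, T)`, `u(x, T) = h(x)`:
the value function of the feedback strategy `pol`. -/
structure IsPolicyValue (σ r K T lam : ℝ) (pol u : ℝ → ℝ → ℝ) : Prop where
  classical : IsBoundedClassical T u
  equation : ∀ x : ℝ, ∀ t ∈ Set.Ico 0 T,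
    dt T u x t + generator σ r u x t + H K lam x (pol x t) (u x t) = 0
  terminal : ∀ x : ℝ, u x T = h K x

/-- `p` is a maximizer over `(0, ∞)` of `H(x, ·, v)`. -/
def IsGreedy (K lam x v p : ℝ) : Prop :=
  p ∈ Set.Ioi (0 : ℝ) ∧ IsMaxOn (fun q => H K lam x q v) (Set.Ioi 0) p

/-- Policy iteration started from the guess `u0`: `pol (n + 1)` is greedy for `u n`, and
`u (n + 1)` is the value function of `pol (n + 1)`. The entry `pol 0` is not used. -/
structure IsPolicyIteration (σ r K T lam : ℝ) (u0 : BoundedContinuousFunction ℝ ℝ)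
    (u pol : ℕ → ℝ → ℝ → ℝ) : Prop where
  initial : ∀ x : ℝ, ∀ t ∈ Set.Icc 0 T, u 0 x t = u0 x
  update : ∀ n : ℕ, ∀ x : ℝ, ∀ t ∈ Set.Icc 0 T, IsGreedy K lam x (u n x t) (pol (n + 1) x t)
  evaluation : ∀ n : ℕ, IsPolicyValue σ r K T lam (pol (n + 1)) (u (n + 1))

/-- Supremum norm on `ℝ × [0, T]`, used here for bounded functions only. -/
noncomputable def supNorm (T : ℝ) (f : ℝ → ℝ → ℝ) : ℝ :=
  ⨆ q : ℝ × Set.Icc 0 T, |f q.1 q.2|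

/-- `‖(h - v)⁺‖_∞` on `ℝ × [0, T]`. -/
noncomputable def deficit (K T : ℝ) (v : ℝ → ℝ → ℝ) : ℝ :=
  supNorm T (fun x t => max (h K x - v x t) 0)

/-- The greedy action exists, is unique, and equals `exp (-(v - h(x)) / lam)`. -/
theorem isGreedy_iff {K lam x v p : ℝ} (hlam : 0 < lam) :
    IsGreedy K lam x v p ↔ p = Real.exp (-(v - h K x) / lam) := by
  set a := Real.exp (-(v - h K x) / lam) with ha
  have hapos : 0 < a := Real.exp_pos _
  have hlog : lam * Real.log a = h K x - v := by
    rw [ha, Real.log_exp]; field_simp; ring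
  have key : ∀ q : ℝ, 0 < q → H K lam x a v - H K lam x q v
      = lam * q * (a / q - 1 - Real.log (a / q)) := by
    intro q hq
    rw [Real.log_div hapos.ne' hq.ne']
    unfold H R
    rw [← hlog]
    field_simp
    ring
  constructor
  · rintro ⟨hp, hmax⟩
    have hp' : 0 < p := hp
    have h1 : H K lam x a v ≤ H K lam x p v := hmax (show a ∈ Set.Ioi (0 : ℝ) from hapos)
    by_contra hne
    have h2 : a / p ≠ 1 := by
      intro h3
      rw [div_eq_one_iff_eq hp'.ne'] at h3
      exact hne h3.symm
    have h4 := Real.log_lt_sub_one_of_pos (div_pos hapos hp') h2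
    have h5 : 0 < lam * p * (a / p - 1 - Real.log (a / p)) :=
      mul_pos (mul_pos hlam hp') (by linarith)
    have h6 := key p hp'
    linarith
  · rintro rfl
    refine ⟨hapos, fun q hq => ?_⟩
    have hq' : 0 < q := hq
    have h4 := Real.log_le_sub_one_of_pos (div_pos hapos hq')
    have h5 : 0 ≤ lam * q * (a / q - 1 - Real.log (a / q)) :=
      mul_nonneg (mul_pos hlam hq').le (by linarith)
    have h6 := key q hq'
    show H K lam x q v ≤ H K lam x a v
    linarith

end RandomizedStopping

namespace RandomizedStopping

open Set Filter Topology

/-! Everything follows from `comparison`, which tests the operator inequality only where the claimed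
order fails. The nonlinearity `lam * exp(-(v - h) / lam)` is the maximum over `p` of `H`, which is
affine in `v` with slope `-p`. Hence the iterates lie below `uLam` (`le_optimal`) and increase from
`u 1` on (`improvement`), so all later policies are at most `Q = exp(M / lam)` (`pol_le`). Let `e n
= uLam - u (n + 1) ≥ 0`. Where the claimed bound on `e (n + 1)` fails, `e (n + 1)` is positive and
the two equations give `(∂ₜ + L) e (n + 1) ≥ -Q * e n`. Comparison with the solution of `f' = r f -
Q g` amounts to integrating `n` times in time, which produces `(Q (T - t))^n / n!` (`error_le`). The
bound on `e 0` is uniform in `lam ≤ lam0`. -/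

/-! ### Maximum principle on the unbounded strip. -/

/-- A negative second derivative would make the point a local maximum as well, so `f` would be
locally constant. -/
theorem deriv_deriv_nonneg_of_isLocalMin {f : ℝ → ℝ} {a : ℝ} (hmin : IsLocalMin f a)
    (hf : ContinuousAt f a) : 0 ≤ deriv (deriv f) a := by
  by_contra! hneg
  have hmax := isLocalMax_of_deriv_deriv_neg hneg hmin.deriv_eq_zero hf
  have hconst : f =ᶠ[𝓝 a] fun _ => f a := by
    filter_upwards [hmin, hmax] with y h1 h2 using le_antisymm h2 h1
  have h2 : deriv (deriv f) a = 0 := by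
    rw [hconst.deriv.deriv_eq]
    simp
  exact hneg.ne h2

theorem HasDerivWithinAt.nonneg_of_isMinOn_Icc {f : ℝ → ℝ} {f' a b t : ℝ}
    (hf : HasDerivWithinAt f f' (Icc a b) t) (ht : t ∈ Ico a b)
    (hmin : ∀ s ∈ Icc a b, f t ≤ f s) : 0 ≤ f' := by
  have hcone : b - t ∈ posTangentConeAt (Icc a b) t := by
    apply sub_mem_posTangentConeAt_of_segment_subset
    rw [segment_eq_Icc ht.2.le]
    exact Icc_subset_Icc_left ht.1
  have hloc : IsLocalMinOn f (Icc a b) t :=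
    Filter.eventually_of_mem self_mem_nhdsWithin hmin
  have h1 := hloc.hasFDerivWithinAt_nonneg hf.hasFDerivWithinAt hcone
  have h2 : 0 ≤ (b - t) * f' := by simpa using h1
  exact nonneg_of_mul_nonneg_right h2 (sub_pos.2 ht.2)

/-- The barrier `E * (1 + x ^ 2)` is a strict supersolution because `2 * b * x ≤ |b| * (1 + x ^ 2)`.
The factor `D` with `D' = -r D` removes the zeroth-order term, so the sign of `r` is irrelevant. -/
theorem barrier_contradiction {a b r D E ε x u v ut vt ux vx uxx vxx : ℝ} (ha : 0 ≤ a)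
    (hε : 0 < ε) (hE : 0 < E) (hD : 0 < D)
    (hop : ut + (a * uxx + b * ux - r * u) ≤ vt + (a * vxx + b * vx - r * v))
    (ht : 0 ≤ -r * D * (u - v) + D * (ut - vt) + ε * (-(2 * a + |b| + 1) * E * (1 + x ^ 2)))
    (hx : D * (ux - vx) + ε * (E * (2 * x)) = 0)
    (hxx : 0 ≤ D * (uxx - vxx) + ε * (E * 2)) : False := by
  have h1 := mul_le_mul_of_nonneg_left hop hD.le
  have h2 := mul_nonneg ha hxx
  have h3 : b * (D * (ux - vx) + ε * (E * (2 * x))) = 0 := by rw [hx, mul_zero]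
  have h4 : 0 < (2 * a + |b| + 1) * (1 + x ^ 2) - 2 * a - 2 * b * x := by
    have h5 : 2 * b * x ≤ |b| * (1 + x ^ 2) := by
      have h6 : b * x ≤ |b| * |x| := (le_abs_self _).trans_eq (abs_mul _ _)
      have h7 : 2 * |x| ≤ 1 + x ^ 2 := by linarith [sq_nonneg (|x| - 1), sq_abs x]
      linarith [mul_le_mul_of_nonneg_left h7 (abs_nonneg b)]
    have h8 : 0 ≤ a * x ^ 2 := by positivity
    linarith [sq_nonneg x]
  have h5 := mul_pos (mul_pos hε hE) h4
  linarith

/-- Comparison principle: a strict violation `u < v` is excluded if the operator `∂ₜ + L` is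
ordered wherever it occurs. -/
theorem comparison {σ r T : ℝ} {u v : ℝ → ℝ → ℝ}
    (hu : IsBoundedClassical T u) (hv : IsBoundedClassical T v)
    (hterm : ∀ x, v x T ≤ u x T)
    (hop : ∀ x, ∀ t ∈ Ico 0 T, u x t < v x t →
      dt T u x t + generator σ r u x t ≤ dt T v x t + generator σ r v x t) :
    ∀ x, ∀ t ∈ Icc 0 T, v x t ≤ u x t := by
  intro x₁ t₁ ht₁
  by_contra! hlt
  obtain ⟨Bu, hBu⟩ := hu.bounded
  obtain ⟨Bv, hBv⟩ := hv.bounded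
  set a : ℝ := (1 / 2) * σ ^ 2 with ha
  have ha0 : 0 ≤ a := by positivity
  set b : ℝ := r - a with hb
  set k : ℝ := 2 * a + |b| + 1 with hk
  have hk0 : 0 ≤ k := by positivity
  set E : ℝ → ℝ := fun t => Real.exp (k * (T - t)) with hE
  have hE0 : ∀ t, 0 < E t := fun t => Real.exp_pos _
  set D : ℝ → ℝ := fun t => Real.exp (-r * t) with hD
  have hD0 : ∀ t, 0 < D t := fun t => Real.exp_pos _
  -- The penalty uses up half of the assumed violation at `(x₁, t₁)`.
  obtain ⟨ε, hε, hεlt⟩ : ∃ ε > 0, D t₁ * (u x₁ t₁ - v x₁ t₁) + ε * (E t₁ * (1 + x₁ ^ 2)) < 0 := by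
    have h1 : 0 < E t₁ * (1 + x₁ ^ 2) := mul_pos (hE0 _) (by positivity)
    have h2 : 0 < D t₁ * (v x₁ t₁ - u x₁ t₁) := mul_pos (hD0 _) (sub_pos.2 hlt)
    refine ⟨D t₁ * (v x₁ t₁ - u x₁ t₁) / (2 * (E t₁ * (1 + x₁ ^ 2))), by positivity, ?_⟩
    rw [div_mul_eq_mul_div, mul_div_mul_right _ _ h1.ne']
    linarith
  set V : ℝ → ℝ → ℝ := fun x t => D t * (u x t - v x t) + ε * (E t * (1 + x ^ 2)) with hV
  have hVlow : ∀ x, ∀ t ∈ Icc 0 T,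
      ε * (1 + x ^ 2) - Real.exp (|r| * T) * (|Bu| + |Bv|) ≤ V x t := by
    intro x t ht
    have h1 : 1 ≤ E t := Real.one_le_exp (mul_nonneg hk0 (sub_nonneg.2 ht.2))
    have h2 : D t ≤ Real.exp (|r| * T) := Real.exp_le_exp.2 <|
      (mul_le_mul_of_nonneg_right (neg_le_abs r) ht.1).trans
        (mul_le_mul_of_nonneg_left ht.2 (abs_nonneg r))
    have h3 : |u x t - v x t| ≤ |Bu| + |Bv| := (abs_sub _ _).trans <|
      add_le_add ((hBu x t ht).trans (le_abs_self _)) ((hBv x t ht).trans (le_abs_self _))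
    have h4 : D t * |u x t - v x t| ≤ Real.exp (|r| * T) * (|Bu| + |Bv|) :=
      mul_le_mul h2 h3 (abs_nonneg _) (Real.exp_pos _).le
    have h5 : -(D t * |u x t - v x t|) ≤ D t * (u x t - v x t) := by
      rw [← mul_neg]
      exact mul_le_mul_of_nonneg_left (neg_abs_le _) (hD0 t).le
    have h6 : 1 * (1 + x ^ 2) ≤ E t * (1 + x ^ 2) :=
      mul_le_mul_of_nonneg_right h1 (by positivity)
    have h7 := mul_le_mul_of_nonneg_left h6 hε.le
    simp only [hV]
    linarith
  set N : ℝ := Real.exp (|r| * T) * (|Bu| + |Bv|) with hN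
  have hN0 : 0 ≤ N := by positivity
  -- Beyond `X` the penalty dominates the bounded part; the summand 1 gives `X ≤ X ^ 2`, and `|x₁|`
  -- keeps the violation inside the box.
  set X : ℝ := |x₁| + N / ε + 1 with hX
  have hX1 : 1 ≤ X := by
    have : 0 ≤ |x₁| + N / ε := by positivity
    linarith
  have hVout : ∀ x, X ≤ |x| → ∀ t ∈ Icc 0 T, 0 ≤ V x t := by
    intro x hx t ht
    refine le_trans ?_ (hVlow x t ht)
    have h1 : X ≤ x ^ 2 := by
      rw [← sq_abs]
      nlinarith
    have h2 : N / ε ≤ 1 + x ^ 2 := by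
      have := abs_nonneg x₁
      linarith
    rw [div_le_iff₀ hε] at h2
    linarith
  have hVcont : ContinuousOn (fun q : ℝ × ℝ => V q.1 q.2) (Icc (-X) X ×ˢ Icc 0 T) := by
    have hsub : Icc (-X) X ×ˢ Icc 0 T ⊆ (univ : Set ℝ) ×ˢ Icc (0 : ℝ) T :=
      prod_mono (subset_univ _) Subset.rfl
    have h1 := (hu.continuousOn.mono hsub).sub (hv.continuousOn.mono hsub)
    have h2 : Continuous fun q : ℝ × ℝ => D q.2 := by simp only [hD]; fun_prop
    have h3 : Continuous fun q : ℝ × ℝ => ε * (E q.2 * (1 + q.1 ^ 2)) := by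
      simp only [hE]; fun_prop
    exact (h2.continuousOn.mul h1).add h3.continuousOn
  have hx₁X : |x₁| ≤ X := by
    have : 0 ≤ N / ε := by positivity
    linarith
  have hmem₁ : (x₁, t₁) ∈ Icc (-X) X ×ˢ Icc 0 T := ⟨abs_le.1 hx₁X, ht₁⟩
  obtain ⟨⟨x₀, t₀⟩, ⟨hx₀, ht₀⟩, hmin'⟩ :=
    (isCompact_Icc.prod isCompact_Icc).exists_isMinOn ⟨_, hmem₁⟩ hVcont
  have hx₀ : x₀ ∈ Icc (-X) X := hx₀
  have ht₀ : t₀ ∈ Icc 0 T := ht₀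
  have hV₀ : V x₀ t₀ < 0 := lt_of_le_of_lt (hmin' hmem₁) hεlt
  have hmin : ∀ x, ∀ t ∈ Icc 0 T, V x₀ t₀ ≤ V x t := by
    intro x t ht
    rcases le_total |x| X with hx | hx
    · exact hmin' (show (x, t) ∈ Icc (-X) X ×ˢ Icc 0 T from ⟨abs_le.1 hx, ht⟩)
    · exact hV₀.le.trans (hVout x hx t ht)
  have hpos : 0 < ε * (E t₀ * (1 + x₀ ^ 2)) :=
    mul_pos hε (mul_pos (hE0 _) (by positivity))
  -- The penalty is positive, so a negative `V` forces a true violation, where `hop` is available.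
  have huv : u x₀ t₀ < v x₀ t₀ := by
    by_contra! hge
    have := mul_nonneg (hD0 t₀).le (sub_nonneg.2 hge)
    simp only [hV] at hV₀
    linarith
  have ht₀' : t₀ ∈ Ico 0 T := by
    refine ⟨ht₀.1, lt_of_le_of_ne ht₀.2 ?_⟩
    rintro rfl
    exact absurd (hterm x₀) (not_le.2 huv)
  have hineq := hop x₀ t₀ ht₀' huv
  have hVt : 0 ≤ -r * D t₀ * (u x₀ t₀ - v x₀ t₀) + D t₀ * (dt T u x₀ t₀ - dt T v x₀ t₀)
      + ε * (-k * E t₀ * (1 + x₀ ^ 2)) := by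
    have hdD : HasDerivAt D (-r * D t₀) t₀ := by
      have := ((hasDerivAt_id t₀).const_mul (-r)).exp
      simpa [hD, mul_comm] using this
    have hdE : HasDerivAt E (-k * E t₀) t₀ := by
      have := (((hasDerivAt_id t₀).const_sub T).const_mul k).exp
      simpa [hE, mul_comm] using this
    have h1 := (hu.differentiable_t x₀ t₀ ht₀').hasDerivWithinAt
    have h2 := (hv.differentiable_t x₀ t₀ ht₀').hasDerivWithinAt
    have h3 := (hdD.hasDerivWithinAt (s := Icc 0 T)).mul (h1.sub h2)
    have h4 := ((hdE.hasDerivWithinAt (s := Icc 0 T)).mul_const (1 + x₀ ^ 2)).const_mul ε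
    exact HasDerivWithinAt.nonneg_of_isMinOn_Icc (f := fun t => V x₀ t) (h3.add h4) ht₀'
      (fun s hs => hmin x₀ s hs)
  have hdVx : ∀ x, HasDerivAt (fun y => V y t₀)
      (D t₀ * (dx u x t₀ - dx v x t₀) + ε * (E t₀ * (2 * x))) x := by
    intro x
    have h1 := (hu.differentiable_x x t₀ ht₀').hasDerivAt
    have h2 := (hv.differentiable_x x t₀ ht₀').hasDerivAt
    have h3 : HasDerivAt (fun y : ℝ => 1 + y ^ 2) (2 * x) x := by
      simpa using (hasDerivAt_pow 2 x).const_add 1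
    exact ((h1.sub h2).const_mul (D t₀)).add ((h3.const_mul (E t₀)).const_mul ε)
  have hlocmin : IsLocalMin (fun y => V y t₀) x₀ :=
    Filter.Eventually.of_forall fun y => hmin y t₀ ht₀
  have hVx : D t₀ * (dx u x₀ t₀ - dx v x₀ t₀) + ε * (E t₀ * (2 * x₀)) = 0 :=
    hlocmin.hasDerivAt_eq_zero (hdVx x₀)
  have hVxx : 0 ≤ D t₀ * (dxx u x₀ t₀ - dxx v x₀ t₀) + ε * (E t₀ * 2) := by
    have h0 := deriv_deriv_nonneg_of_isLocalMin hlocmin (hdVx x₀).continuousAt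
    have h1 : deriv (fun y => V y t₀)
        = fun x => D t₀ * (dx u x t₀ - dx v x t₀) + ε * (E t₀ * (2 * x)) :=
      funext fun x => (hdVx x).deriv
    have h2 := (hu.differentiable_xx x₀ t₀ ht₀').hasDerivAt
    have h3 := (hv.differentiable_xx x₀ t₀ ht₀').hasDerivAt
    have h4 : HasDerivAt (fun y : ℝ => 2 * y) 2 x₀ := by
      simpa using (hasDerivAt_id x₀).const_mul 2
    have h5 := ((h2.sub h3).const_mul (D t₀)).add ((h4.const_mul (E t₀)).const_mul ε)
    rw [h1] at h0
    exact h0.trans_eq h5.deriv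
  simp only [generator, ← ha, ← hb] at hineq
  exact barrier_contradiction ha0 hε (hE0 t₀) (hD0 t₀) hineq hVt hVx hVxx

/-! ### Differences and space-independent functions as test functions for comparison. -/

section Sub

variable {T : ℝ} {u v : ℝ → ℝ → ℝ}

theorem dt_sub (hu : IsBoundedClassical T u) (hv : IsBoundedClassical T v) (x : ℝ) {t : ℝ}
    (ht : t ∈ Ico 0 T) :
    dt T (fun x t => u x t - v x t) x t = dt T u x t - dt T v x t :=
  ((hu.differentiable_t x t ht).hasDerivWithinAt.sub
    (hv.differentiable_t x t ht).hasDerivWithinAt).derivWithin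
      (uniqueDiffOn_Icc (ht.1.trans_lt ht.2) t ⟨ht.1, ht.2.le⟩)

theorem dx_sub (hu : IsBoundedClassical T u) (hv : IsBoundedClassical T v) (x : ℝ) {t : ℝ}
    (ht : t ∈ Ico 0 T) :
    dx (fun x t => u x t - v x t) x t = dx u x t - dx v x t :=
  ((hu.differentiable_x x t ht).hasDerivAt.sub (hv.differentiable_x x t ht).hasDerivAt).deriv

theorem hasDerivAt_dx_sub (hu : IsBoundedClassical T u) (hv : IsBoundedClassical T v) (x : ℝ)
    {t : ℝ} (ht : t ∈ Ico 0 T) :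
    HasDerivAt (fun y => dx (fun x t => u x t - v x t) y t) (dxx u x t - dxx v x t) x := by
  rw [show (fun y => dx (fun x t => u x t - v x t) y t) = fun y => dx u y t - dx v y t from
    funext fun y => dx_sub hu hv y ht]
  exact (hu.differentiable_xx x t ht).hasDerivAt.sub (hv.differentiable_xx x t ht).hasDerivAt

theorem dxx_sub (hu : IsBoundedClassical T u) (hv : IsBoundedClassical T v) (x : ℝ) {t : ℝ}
    (ht : t ∈ Ico 0 T) :
    dxx (fun x t => u x t - v x t) x t = dxx u x t - dxx v x t :=
  (hasDerivAt_dx_sub hu hv x ht).deriv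

theorem generator_sub (σ r : ℝ) (hu : IsBoundedClassical T u) (hv : IsBoundedClassical T v) (x : ℝ)
    {t : ℝ} (ht : t ∈ Ico 0 T) :
    generator σ r (fun x t => u x t - v x t) x t = generator σ r u x t - generator σ r v x t := by
  simp only [generator, dx_sub hu hv x ht, dxx_sub hu hv x ht]
  ring

theorem IsBoundedClassical.sub (hu : IsBoundedClassical T u) (hv : IsBoundedClassical T v) :
    IsBoundedClassical T (fun x t => u x t - v x t) where
  bounded := by
    obtain ⟨Bu, hBu⟩ := hu.bounded
    obtain ⟨Bv, hBv⟩ := hv.bounded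
    exact ⟨Bu + Bv, fun x t ht => (abs_sub _ _).trans (add_le_add (hBu x t ht) (hBv x t ht))⟩
  continuousOn := hu.continuousOn.sub hv.continuousOn
  differentiable_t x t ht := (hu.differentiable_t x t ht).sub (hv.differentiable_t x t ht)
  differentiable_x x t ht := (hu.differentiable_x x t ht).sub (hv.differentiable_x x t ht)
  differentiable_xx x _ ht := (hasDerivAt_dx_sub hu hv x ht).differentiableAt
  continuousOn_dt := (hu.continuousOn_dt.sub hv.continuousOn_dt).congr
    fun q hq => dt_sub hu hv q.1 hq.2
  continuousOn_dx := (hu.continuousOn_dx.sub hv.continuousOn_dx).congr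
    fun q hq => dx_sub hu hv q.1 hq.2
  continuousOn_dxx := (hu.continuousOn_dxx.sub hv.continuousOn_dxx).congr
    fun q hq => dxx_sub hu hv q.1 hq.2

end Sub

theorem isBoundedClassical_of_time {T : ℝ} {f f' : ℝ → ℝ}
    (hf : ∀ t, HasDerivAt f (f' t) t) (hf' : Continuous f') :
    IsBoundedClassical T (fun _ t => f t) := by
  have hc : Continuous f := continuous_iff_continuousAt.2 fun t => (hf t).continuousAt
  have hdx : dx (fun _ t => f t) = fun _ _ => 0 := by
    funext x t; simp [dx]
  have hdxx : dxx (fun _ t => f t) = fun _ _ => 0 := by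
    funext x t; simp [dxx, hdx]
  refine ⟨?_, ?_, ?_, ?_, ?_, ?_, ?_, ?_⟩
  · obtain ⟨B, hB⟩ := isCompact_Icc.exists_bound_of_continuousOn (s := Icc 0 T) hc.continuousOn
    exact ⟨B, fun _ t ht => hB t ht⟩
  · exact (hc.comp continuous_snd).continuousOn
  · exact fun _ t _ => (hf t).differentiableAt.differentiableWithinAt
  · exact fun _ _ _ => differentiableAt_const _
  · intro _ _ _
    rw [hdx]
    exact differentiableAt_const _
  · refine ((hf'.comp continuous_snd).continuousOn).congr fun q hq => ?_
    have hq2 : q.2 ∈ Ico 0 T := hq.2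
    exact (hf q.2).hasDerivWithinAt.derivWithin
      (uniqueDiffOn_Icc (hq2.1.trans_lt hq2.2) q.2 ⟨hq2.1, hq2.2.le⟩)
  · rw [hdx]; exact continuousOn_const
  · rw [hdxx]; exact continuousOn_const

theorem operator_of_time {σ r T : ℝ} {f f' : ℝ → ℝ} (hf : ∀ t, HasDerivAt f (f' t) t)
    (x : ℝ) {t : ℝ} (ht : t ∈ Ico 0 T) :
    dt T (fun _ t => f t) x t + generator σ r (fun _ t => f t) x t = f' t - r * f t := by
  have h1 : dt T (fun _ t => f t) x t = f' t :=
    (hf t).hasDerivWithinAt.derivWithin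
      (uniqueDiffOn_Icc (ht.1.trans_lt ht.2) t ⟨ht.1, ht.2.le⟩)
  have h2 : ∀ y, dx (fun _ t => f t) y t = 0 := fun y => by simp [dx]
  have h3 : dxx (fun _ t => f t) x t = 0 := by simp [dxx, h2]
  rw [generator, h1, h2, h3]
  ring

/-! ### Payoff and Hamiltonian. -/

theorem h_nonneg (K x : ℝ) : 0 ≤ h K x := le_max_right _ _

theorem h_le {K : ℝ} (hK : 0 ≤ K) (x : ℝ) : h K x ≤ K :=
  max_le (by linarith [Real.exp_pos x]) hK

theorem H_greedy {K lam x v p : ℝ} (hlam : 0 < lam) (hp : IsGreedy K lam x v p) :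
    H K lam x p v = lam * p := by
  rw [isGreedy_iff hlam] at hp
  subst hp
  unfold H R
  rw [Real.log_exp]
  field_simp
  ring

theorem H_shift (K lam x p v w : ℝ) : H K lam x p w = H K lam x p v - p * (w - v) := by
  unfold H; ring

theorem H_le_exp {K lam x p v : ℝ} (hlam : 0 < lam) (hp : 0 < p) :
    H K lam x p v ≤ lam * Real.exp (-(v - h K x) / lam) := by
  have hg : IsGreedy K lam x v (Real.exp (-(v - h K x) / lam)) := (isGreedy_iff hlam).2 rfl
  exact (hg.2 (show p ∈ Ioi (0 : ℝ) from hp)).trans_eq (H_greedy hlam hg)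

/-! ### Monotonicity of policy iteration. -/

section Iteration

variable {σ r K T lam : ℝ} {u0 : BoundedContinuousFunction ℝ ℝ} {uLam : ℝ → ℝ → ℝ}
  {u pol : ℕ → ℝ → ℝ → ℝ}

/-- The exponential dominates `H` at every positive action, so `uLam` is a supersolution of every
policy equation. -/
theorem IsPolicyIteration.le_optimal (hlam : 0 < lam) (hopt : IsOptimalValue σ r K T lam uLam)
    (hit : IsPolicyIteration σ r K T lam u0 u pol) (n : ℕ) :
    ∀ x, ∀ t ∈ Icc 0 T, u (n + 1) x t ≤ uLam x t := by
  have hev := hit.evaluation n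
  refine comparison (σ := σ) (r := r) hopt.classical hev.classical
    (fun x => by rw [hopt.terminal, hev.terminal]) ?_
  intro x t ht hlt
  have hp : 0 < pol (n + 1) x t := (hit.update n x t (Ico_subset_Icc_self ht)).1
  have h1 := hopt.equation x t ht
  have h2 := hev.equation x t ht
  have h3 := H_le_exp (K := K) (x := x) (v := uLam x t) hlam hp
  rw [H_shift K lam x _ (u (n + 1) x t)] at h3
  have h4 := mul_pos hp (sub_pos.2 hlt)
  linarith

/-- The new policy is greedy for `u (n + 1)`, so it does at least as well in `H` at that value as
the old one. -/
theorem IsPolicyIteration.improvement (hit : IsPolicyIteration σ r K T lam u0 u pol) (n : ℕ) :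
    ∀ x, ∀ t ∈ Icc 0 T, u (n + 1) x t ≤ u (n + 2) x t := by
  have hev := hit.evaluation n
  have hev' := hit.evaluation (n + 1)
  refine comparison (σ := σ) (r := r) hev'.classical hev.classical
    (fun x => by rw [hev'.terminal, hev.terminal]) ?_
  intro x t ht hlt
  have hlt : u (n + 1 + 1) x t < u (n + 1) x t := hlt
  have hg := hit.update n x t (Ico_subset_Icc_self ht)
  have hg' := hit.update (n + 1) x t (Ico_subset_Icc_self ht)
  have h1 := hev.equation x t ht
  have h2 := hev'.equation x t ht
  have h3 : H K lam x (pol (n + 1) x t) (u (n + 1) x t)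
      ≤ H K lam x (pol (n + 1 + 1) x t) (u (n + 1) x t) := hg'.2 hg.1
  rw [H_shift K lam x _ (u (n + 1) x t)] at h2
  have hp : 0 < pol (n + 1 + 1) x t := hg'.1
  have h4 := mul_pos hp (sub_pos.2 hlt)
  show dt T (u (n + 1 + 1)) x t + generator σ r (u (n + 1 + 1)) x t ≤ _
  linarith

theorem IsPolicyIteration.first_le (hit : IsPolicyIteration σ r K T lam u0 u pol) (n : ℕ) :
    ∀ x, ∀ t ∈ Icc 0 T, u 1 x t ≤ u (n + 1) x t := by
  induction n with
  | zero => exact fun _ _ _ => le_rfl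
  | succ n ih => exact fun x t ht => (ih x t ht).trans (hit.improvement n x t ht)

/-! ### Bounds uniform in the temperature. -/

theorem hasDerivAt_exp_backward (A k T t : ℝ) :
    HasDerivAt (fun s => A * Real.exp (k * (T - s))) (-k * (A * Real.exp (k * (T - t)))) t := by
  have h1 := ((((hasDerivAt_id t).const_sub T).const_mul k).exp).const_mul A
  refine h1.congr_deriv ?_
  simp only [id]
  ring

/-- Above the level `K ≥ h` the source is at most `lam ≤ lam0`; the extra 1 in the exponent absorbs
it. -/
theorem IsOptimalValue.le_of_temperature_le {lam0 : ℝ} (hK : 0 ≤ K) (hlam : 0 < lam)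
    (hle : lam ≤ lam0) (hopt : IsOptimalValue σ r K T lam uLam) :
    ∀ x, ∀ t ∈ Icc 0 T, uLam x t ≤ (K + lam0) * Real.exp ((|r| + 1) * (T - t)) := by
  have hd := hasDerivAt_exp_backward (K + lam0) (|r| + 1) T
  have hge : ∀ t ∈ Icc 0 T, K + lam0 ≤ (K + lam0) * Real.exp ((|r| + 1) * (T - t)) := by
    intro t ht
    refine le_mul_of_one_le_right (by linarith) (Real.one_le_exp ?_)
    exact mul_nonneg (by positivity) (sub_nonneg.2 ht.2)
  refine comparison (σ := σ) (r := r)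
    (isBoundedClassical_of_time hd (by fun_prop)) hopt.classical ?_ ?_
  · intro x
    rw [hopt.terminal]
    simp only [sub_self, mul_zero, Real.exp_zero, mul_one]
    linarith [h_le hK x]
  · intro x t ht hlt
    rw [operator_of_time hd x ht]
    have h1 := hge t (Ico_subset_Icc_self ht)
    have h2 := hopt.equation x t ht
    have h3 : Real.exp (-(uLam x t - h K x) / lam) ≤ 1 := by
      rw [Real.exp_le_one_iff]
      exact div_nonpos_of_nonpos_of_nonneg (by linarith [h_le hK x]) hlam.le
    have h4 : lam * Real.exp (-(uLam x t - h K x) / lam) ≤ lam := mul_le_of_le_one_right hlam.le h3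
    have h5 : 0 ≤ (|r| + r) * ((K + lam0) * Real.exp ((|r| + 1) * (T - t))) :=
      mul_nonneg (by linarith [neg_abs_le r]) (by linarith)
    linarith

/-- Below `-‖u0‖` one has `u 1 ≤ u0`, and there `H = lam * p + p * (u0 - u 1)` is nonnegative,
however large `p` is. -/
theorem IsPolicyIteration.le_first (hlam : 0 < lam)
    (hit : IsPolicyIteration σ r K T lam u0 u pol) :
    ∀ x, ∀ t ∈ Icc 0 T, -‖u0‖ * Real.exp (|r| * (T - t)) ≤ u 1 x t := by
  have hd := hasDerivAt_exp_backward (-‖u0‖) |r| T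
  have hev := hit.evaluation 0
  refine comparison (σ := σ) (r := r) hev.classical
    (isBoundedClassical_of_time hd (by fun_prop)) ?_ ?_
  · intro x
    rw [hev.terminal]
    simp only [sub_self, mul_zero, Real.exp_zero, mul_one]
    linarith [h_nonneg K x, norm_nonneg u0]
  · intro x t ht hlt
    rw [operator_of_time hd x ht]
    have hg := hit.update 0 x t (Ico_subset_Icc_self ht)
    have h1 : ‖u0‖ ≤ ‖u0‖ * Real.exp (|r| * (T - t)) :=
      le_mul_of_one_le_right (norm_nonneg _)
        (Real.one_le_exp (mul_nonneg (abs_nonneg _) (sub_nonneg.2 ht.2.le)))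
    have h2 := hev.equation x t ht
    have hp : 0 < pol (0 + 1) x t := hg.1
    rw [H_shift K lam x _ (u 0 x t), H_greedy hlam hg,
      hit.initial x t (Ico_subset_Icc_self ht)] at h2
    have h3 : -‖u0‖ ≤ u0 x := (abs_le.1 (u0.norm_coe_le_norm x)).1
    have h4 : 0 ≤ pol (0 + 1) x t * (u0 x - u (0 + 1) x t) :=
      mul_nonneg hp.le (by linarith)
    have h5 : 0 ≤ (|r| + r) * (‖u0‖ * Real.exp (|r| * (T - t))) :=
      mul_nonneg (by linarith [neg_abs_le r]) (by positivity)
    have h6 := mul_pos hlam hp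
    linarith

/-! ### Factorial error estimate. -/

theorem le_deficit (hK : 0 ≤ K) {v : ℝ → ℝ → ℝ} (hv : IsBoundedClassical T v) (x : ℝ) {t : ℝ}
    (ht : t ∈ Icc 0 T) : h K x - v x t ≤ deficit K T v := by
  obtain ⟨B, hB⟩ := hv.bounded
  have hbdd : BddAbove (range fun q : ℝ × Icc 0 T => |max (h K q.1 - v q.1 q.2) 0|) := by
    refine ⟨K + |B|, ?_⟩
    rintro _ ⟨q, rfl⟩
    have h1 := (abs_le.1 (hB q.1 q.2 q.2.2)).1
    have h2 := le_abs_self B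
    dsimp only
    rw [abs_of_nonneg (le_max_right _ _)]
    exact max_le (by linarith [h_le hK q.1]) (by positivity)
  calc h K x - v x t ≤ |max (h K x - v x t) 0| := (le_max_left _ _).trans (le_abs_self _)
    _ ≤ deficit K T v := le_ciSup hbdd (x, ⟨t, ht⟩)

/-- Monotonicity reduces every later deficit to that of `u 1`. The index starts at 2, as `pol 1` is
greedy for the arbitrary guess. -/
theorem IsPolicyIteration.pol_le (hK : 0 ≤ K) (hlam : 0 < lam)
    (hit : IsPolicyIteration σ r K T lam u0 u pol) (n : ℕ) (x : ℝ) {t : ℝ} (ht : t ∈ Icc 0 T) :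
    pol (n + 2) x t ≤ Real.exp (deficit K T (u 1) / lam) := by
  rw [(isGreedy_iff hlam).1 (hit.update (n + 1) x t ht)]
  have h1 := le_deficit hK (hit.evaluation 0).classical x ht
  have h2 := hit.first_le n x t ht
  refine Real.exp_le_exp.2 (div_le_div_of_nonneg_right ?_ hlam.le)
  simp only [zero_add] at h1
  linarith

/-- Solution of `f' = r f - Q g`, `f(T) = 0` for the profile `g` with exponent `n` in place
of `n + 1`. -/
theorem hasDerivAt_profile (A Q r T : ℝ) (n : ℕ) (t : ℝ) :
    HasDerivAt
      (fun s => A * Real.exp (-r * (T - s)) * (Q ^ (n + 1) * (T - s) ^ (n + 1) / (n + 1).factorial))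
      (r * (A * Real.exp (-r * (T - t)) * (Q ^ (n + 1) * (T - t) ^ (n + 1) / (n + 1).factorial))
        - Q * (A * Real.exp (-r * (T - t)) * (Q ^ n * (T - t) ^ n / n.factorial))) t := by
  have h1 := hasDerivAt_exp_backward A (-r) T t
  have h2 := ((((hasDerivAt_id t).const_sub T).pow (n + 1)).const_mul (Q ^ (n + 1))).div_const
    ((n + 1).factorial : ℝ)
  refine (h1.mul h2).congr_deriv ?_
  have h3 : (n.factorial : ℝ) ≠ 0 := by positivity
  have h4 : (n : ℝ) + 1 ≠ 0 := by positivity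
  simp only [id, Nat.factorial_succ, Nat.add_sub_cancel, Pi.pow_apply]
  push_cast
  field_simp
  ring

theorem IsPolicyIteration.error_le {A : ℝ} (hA : 0 ≤ A) (hK : 0 ≤ K) (hlam : 0 < lam)
    (hopt : IsOptimalValue σ r K T lam uLam) (hit : IsPolicyIteration σ r K T lam u0 u pol)
    (hfirst : ∀ x, ∀ t ∈ Icc 0 T, uLam x t - u 1 x t ≤ A * Real.exp (-r * (T - t))) (n : ℕ) :
    ∀ x, ∀ t ∈ Icc 0 T, uLam x t - u (n + 1) x t ≤
      A * Real.exp (-r * (T - t)) *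
        (Real.exp (deficit K T (u 1) / lam) ^ n * (T - t) ^ n / n.factorial) := by
  induction n with
  | zero => simpa using hfirst
  | succ n ih =>
    have hev := hit.evaluation (n + 1)
    set Q := Real.exp (deficit K T (u 1) / lam) with hQ
    have hd := hasDerivAt_profile A Q r T n
    have hW : ∀ m : ℕ, ∀ t ∈ Icc 0 T,
        0 ≤ A * Real.exp (-r * (T - t)) * (Q ^ m * (T - t) ^ m / m.factorial) := by
      intro m t ht
      have h1 : 0 ≤ T - t := sub_nonneg.2 ht.2
      positivity
    refine comparison (σ := σ) (r := r) (isBoundedClassical_of_time hd (by fun_prop))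
      (hopt.classical.sub hev.classical) ?_ ?_
    · intro x
      rw [hopt.terminal, hev.terminal]
      simp
    · intro x t ht hlt
      have ht' := Ico_subset_Icc_self ht
      rw [operator_of_time hd x ht, dt_sub hopt.classical hev.classical x ht,
        generator_sub σ r hopt.classical hev.classical x ht]
      have hg := hit.update (n + 1) x t ht'
      have hp : 0 < pol (n + 1 + 1) x t := hg.1
      have h1 := hopt.equation x t ht
      have h2 := hev.equation x t ht
      rw [H_shift K lam x _ (u (n + 1) x t), H_greedy hlam hg] at h2
      have h3 : lam * Real.exp (-(uLam x t - h K x) / lam) ≤ lam * pol (n + 1 + 1) x t := by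
        rw [(isGreedy_iff hlam).1 hg]
        refine mul_le_mul_of_nonneg_left (Real.exp_le_exp.2 ?_) hlam.le
        refine div_le_div_of_nonneg_right ?_ hlam.le
        linarith [hit.le_optimal hlam hopt n x t ht']
      have h4 : pol (n + 1 + 1) x t * (uLam x t - u (n + 1) x t)
          ≤ Q * (A * Real.exp (-r * (T - t)) * (Q ^ n * (T - t) ^ n / n.factorial)) :=
        mul_le_mul (hit.pol_le hK hlam n x ht') (ih x t ht')
          (sub_nonneg.2 (hit.le_optimal hlam hopt n x t ht')) (Real.exp_pos _).le
      -- Where the bound fails, the new error exceeds a nonnegative profile, so its own term has a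
      -- favourable sign and can be dropped.
      have h5 : 0 ≤ pol (n + 1 + 1) x t * (uLam x t - u (n + 1 + 1) x t) :=
        mul_nonneg hp.le ((hW (n + 1) t ht').trans hlt.le)
      linarith

end Iteration

end RandomizedStopping

/-! ### The choice of the constant. -/

theorem mainTheorem3 (σ r K T : ℝ) (hσ : 0 < σ) (hK : 0 < K) (hT : 0 < T)
    (u0 : BoundedContinuousFunction ℝ ℝ) (lam0 : ℝ) (hlam0 : 0 < lam0) :
    ∃ C : ℝ, 0 < C ∧ ∀ lam : ℝ, 0 < lam → lam ≤ lam0 →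
      ∀ uLam : ℝ → ℝ → ℝ, RandomizedStopping.IsOptimalValue σ r K T lam uLam →
      ∀ u pol : ℕ → ℝ → ℝ → ℝ, RandomizedStopping.IsPolicyIteration σ r K T lam u0 u pol →
      ∀ n : ℕ, 1 ≤ n →
        RandomizedStopping.supNorm T (fun x t => u (n + 1) x t - uLam x t) ≤
          C ^ n * (T ^ n / (n.factorial : ℝ)) *
            Real.exp ((n : ℝ) * (RandomizedStopping.deficit K T (u 1) / lam + r * T)) := by
  set B : ℝ := (K + lam0) * Real.exp ((|r| + 1) * T) + ‖u0‖ * Real.exp (|r| * T) with hB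
  have hB0 : 0 ≤ B := by positivity
  set A : ℝ := B * Real.exp (|r| * T) with hA
  have hA0 : 0 ≤ A := by positivity
  -- With `1 ≤ G` and `1 ≤ n`, the single prefactor is absorbed into `G ^ n`.
  set G : ℝ := max 1 (A * Real.exp (|r| * T)) with hG
  have hG1 : 1 ≤ G := le_max_left _ _
  have hG0 : 0 < G := one_pos.trans_le hG1
  -- The factor `exp(|r| T)` offsets `exp(r T)` in the claimed bound, which is below 1 for negative
  -- `r`.
  refine ⟨G * Real.exp (|r| * T), by positivity, ?_⟩
  intro lam hlam hle uLam hopt u pol hit n hn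
  have hfirst : ∀ x, ∀ t ∈ Set.Icc 0 T, uLam x t - u 1 x t ≤ A * Real.exp (-r * (T - t)) := by
    intro x t ht
    have hTt : 0 ≤ T - t := sub_nonneg.2 ht.2
    have hTt' : T - t ≤ T := by linarith [ht.1]
    have h1 := hopt.le_of_temperature_le hK.le hlam hle x t ht
    have h2 := hit.le_first hlam x t ht
    have h3 : (K + lam0) * Real.exp ((|r| + 1) * (T - t))
        ≤ (K + lam0) * Real.exp ((|r| + 1) * T) := by gcongr
    have h4 : ‖u0‖ * Real.exp (|r| * (T - t)) ≤ ‖u0‖ * Real.exp (|r| * T) := by gcongr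
    have h5 : 1 ≤ Real.exp (|r| * T) * Real.exp (-r * (T - t)) := by
      rw [← Real.exp_add]
      refine Real.one_le_exp ?_
      have h6 : r * (T - t) ≤ |r| * T :=
        mul_le_mul (le_abs_self r) hTt' hTt (abs_nonneg r)
      linarith
    calc uLam x t - u 1 x t ≤ B := by linarith
      _ ≤ B * (Real.exp (|r| * T) * Real.exp (-r * (T - t))) := le_mul_of_one_le_right hB0 h5
      _ = A * Real.exp (-r * (T - t)) := by rw [hA]; ring
  have herr := hit.error_le hA0 hK.le hlam hopt hfirst n
  set Q := Real.exp (RandomizedStopping.deficit K T (u 1) / lam) with hQ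
  have : Nonempty (Set.Icc 0 T) := ⟨⟨0, le_rfl, hT.le⟩⟩
  refine ciSup_le ?_
  rintro ⟨x, t, ht⟩
  have hTt : 0 ≤ T - t := sub_nonneg.2 ht.2
  have hTt' : T - t ≤ T := by linarith [ht.1]
  have hnonpos := sub_nonpos.2 (hit.le_optimal hlam hopt n x t ht)
  have hdisc : Real.exp (-r * (T - t)) ≤ Real.exp (|r| * T) := Real.exp_le_exp.2 <|
    mul_le_mul (neg_le_abs r) hTt' hTt (abs_nonneg r)
  have hexp : Real.exp ((n : ℝ) * (RandomizedStopping.deficit K T (u 1) / lam + r * T))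
      = Q ^ n * Real.exp (r * T) ^ n := by
    rw [hQ, Real.exp_nat_mul, Real.exp_add, mul_pow]
  have hone : 1 ≤ Real.exp (|r| * T) * Real.exp (r * T) := by
    rw [← Real.exp_add, ← add_mul]
    exact Real.one_le_exp (mul_nonneg (by linarith [neg_abs_le r]) hT.le)
  dsimp only
  rw [abs_of_nonpos hnonpos, neg_sub, hexp]
  calc uLam x t - u (n + 1) x t
      ≤ A * Real.exp (-r * (T - t)) * (Q ^ n * (T - t) ^ n / n.factorial) := herr x t ht
    _ ≤ A * Real.exp (|r| * T) * (Q ^ n * T ^ n / n.factorial) := by gcongr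
    _ ≤ G ^ n * (Q ^ n * T ^ n / n.factorial) := by
        refine mul_le_mul_of_nonneg_right ?_ (by positivity)
        exact (le_max_right _ _).trans (le_self_pow₀ hG1 (by omega))
    _ ≤ G ^ n * (Q ^ n * T ^ n / n.factorial) * (Real.exp (|r| * T) * Real.exp (r * T)) ^ n :=
        le_mul_of_one_le_right (by positivity) (one_le_pow₀ hone)
    _ = (G * Real.exp (|r| * T)) ^ n * (T ^ n / n.factorial) * (Q ^ n * Real.exp (r * T) ^ n) := by
        rw [mul_pow, mul_pow]; ring
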